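/- Let $S$ be a complete separable metric space with its Borel $\sigma$-algebra, $\pi$ a probability measure on $S$, and $Q$ a Markov transition kernel on $S$ which is reversible with respect to $\pi$; $\psi$-irreducible for some probability measure $\psi$ (for every measurable $A$ with $\psi(A)>0$ and every $x$ there is $t\ge 1$ with $Q^t(x,A)>0$); aperiodic (there are no $d\ge 2$ and disjoint measurable sets $D_0,\dots,D_{d-1}$ covering $\psi$-almost all of $S$ with $Q(x,D_{i+1 \bmod d})=1$ for all $x\in D_i$); and satisfies the geometric drift condition: there are a small set $C$ (a measurable set such that for some $t\ge 1$ and some nonzero measure $\nu$, $Q^t(x,\cdot)\ge\nu$ for all $x\in C$), constants $\beta>0$, $b<\infty$ and a measurable $V:S\to[1,\infty)$ with $QV-V\le-\beta V+b\,1_C$. Let $X_0,X_1,\dots$ be a Markov chain with transition kernel $Q$ and arbitrary initial law, and let $g\in L^2(\pi)$. Let $\gamma(k)=\mathrm{Cov}_\pi(g(X_0),g(X_{|k|}))$, $k\in\mathbb Z$, be the autocovariance sequence of the stationary chain ($X_0\sim\pi$). A representing measure of a sequence $m:\mathbb Z\to\mathbb R$ is a finite positive measure $\mu$ on $\mathbb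 R$, supported on a compact interval, such that $m(k)=\int x^{|k|}\,\mu(dx)$ for all $k\in\mathbb Z$. For $\delta>0$ and $r\in\ell_2(\mathbb Z)$ let $\Pi_\delta(r)$ be the minimizer of $\sum_{k\in\mathbb Z}(r(k)-m(k))^2$ over all $m\in\ell_2(\mathbb Z)$ that have a representing measure supported on $[-1+\delta,1-\delta]$. For each $M$ let $r_M$ be an initial autocovariance estimator, i.e. a sequence $(r_M(k))_{k\in\mathbb Z}$ computed from $X_0,\dots,X_{M-1}$, such that: (i) for each $k$, $r_M(k)\to\gamma(k)$ almost surely as $M\to\infty$; (ii) $r_M(k)=0$ for all $k\ge n(M)$, for some $n(M)<\infty$; (iii) $r_M(k)=r_M(-k)$ and $|r_M(k)|\le r_M(0)$ for all $k$. Then $\gamma$ has a unique representing measure $F$. If $\delta>0$ is such that $F$ is supported on $[-1+\delta,1-\delta]$, then almost surely the following holds: for every $M$ the moment least squares estimator $\Pi_\delta(r_M)$ exists, is unique and has a unique representing measure $\hat\mu_{\delta,M}$, and $\hat\mu_{\delta,M}\to F$ vaguely as $M\to\infty$, i.e. $\int f\,d\hat\mu_{\delta,M}\to\int f\,dF$ for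 every continuous $f:\mathbb R\to\mathbb R$ vanishing at infinity. -/

import Mathlib

open MeasureTheory ProbabilityTheory Filter Topology Set
open scoped ZeroAtInfty

noncomputable section

namespace MomentLS

section MarkovChain

variable {S Ω : Type*} [MeasurableSpace S] [MeasurableSpace Ω]

/-- `X₀, X₁, …` is a (time homogeneous) Markov chain on `(Ω, P)` with transition kernel `Q`
and arbitrary initial law: almost surely
`P(X_{t+1} ∈ A | X₀, …, X_t) = Q(X_t, A)` for every measurable `A`. -/
structure IsMarkovChain (Q : Kernel S S) (P : Measure Ω) (X : ℕ → Ω → S) : Prop where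
  measurable : ∀ t, Measurable (X t)
  markov : ∀ t, ∀ A, MeasurableSet A →
    P[(X (t + 1) ⁻¹' A).indicator (fun _ => (1 : ℝ)) |
        ⨆ j ∈ Set.Iic t, MeasurableSpace.comap (X j) inferInstance]
      =ᵐ[P] fun ω => (Q (X t ω)).real A

/-- `ψ`-irreducibility: every set of positive `ψ`-measure can be reached from every state in a
positive number of steps. -/
def IsPsiIrreducible (Q : Kernel S S) (ψ : Measure S) : Prop :=
  ∀ A, MeasurableSet A → 0 < ψ A → ∀ x, ∃ t : ℕ, 0 < t ∧ 0 < (Q ^ t) x A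

/-- `C` is a small set: some step of the chain is minorised on `C` by a nontrivial measure. -/
def IsSmallSet (Q : Kernel S S) (C : Set S) : Prop :=
  MeasurableSet C ∧ ∃ t : ℕ, 0 < t ∧ ∃ ν : Measure S, ν ≠ 0 ∧
    ∀ x ∈ C, ∀ A, MeasurableSet A → ν A ≤ (Q ^ t) x A

/-- The geometric drift condition `QV - V ≤ -βV + b 1_C` with a small set `C`, `β > 0`, `b < ∞`
and `V : S → [1, ∞)`; here `QV` is finite. -/
def HasGeometricDrift (Q : Kernel S S) : Prop :=
  ∃ (C : Set S) (β b : ℝ) (V : S → ℝ), IsSmallSet Q C ∧ 0 < β ∧ Measurable V ∧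
    (∀ x, 1 ≤ V x) ∧
    ∀ x, Integrable V (Q x) ∧
      (∫ y, V y ∂(Q x)) - V x ≤ -β * V x + b * C.indicator (fun _ => (1 : ℝ)) x

/-- Aperiodicity of a `ψ`-irreducible kernel: for no `d ≥ 2` is there a `d`-cycle, that is, a
cyclically ordered family of disjoint measurable sets `D₀, …, D_{d-1}`, covering `ψ`-almost
everything, such that the chain moves from `D_i` to `D_{i+1}` with probability one. -/
def IsAperiodic (Q : Kernel S S) (ψ : Measure S) : Prop :=
  ¬ ∃ d : ℕ, 2 ≤ d ∧ ∃ D : ZMod d → Set S,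
    (∀ i, MeasurableSet (D i)) ∧ Pairwise (fun i j => Disjoint (D i) (D j)) ∧
    (∀ i, ∀ x ∈ D i, Q x (D (i + 1)) = 1) ∧ ψ (⋃ i, D i)ᶜ = 0

/-- The autocovariance sequence `γ(k) = Cov_π (g(X₀), g(X_{|k|}))`, `k ∈ ℤ`, of the stationary
chain: if `X₀ ∼ π`, the law of `(X₀, X_{|k|})` is `π(dx) Q^{|k|}(x, dy)`. -/
def autocov (Q : Kernel S S) (π : Measure S) (g : S → ℝ) (k : ℤ) : ℝ :=
  cov[fun p : S × S => g p.1, fun p : S × S => g p.2; π ⊗ₘ (Q ^ k.natAbs)]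

/-- Admissible initial autocovariance estimates `r M ω`, `M = 0, 1, …`, of a sequence `γ`. -/
structure IsInitialEstimator (P : Measure Ω) (γ : ℤ → ℝ) (r : ℕ → Ω → ℤ → ℝ) : Prop where
  tendsto : ∀ k, ∀ᵐ ω ∂P, Tendsto (fun M => r M ω k) atTop (𝓝 (γ k))
  finite_support : ∀ M, ∀ᵐ ω ∂P, ∃ n : ℕ, ∀ k : ℤ, (n : ℤ) ≤ k → r M ω k = 0
  even : ∀ M, ∀ᵐ ω ∂P, ∀ k, r M ω k = r M ω (-k)
  peak : ∀ M, ∀ᵐ ω ∂P, ∀ k, |r M ω k| ≤ r M ω 0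

end MarkovChain

/-- `μ` is a representing measure for `m`: a finite positive measure, supported on some compact
interval, with `m(k) = ∫ x^{|k|} μ(dx)` for all `k ∈ ℤ`. -/
structure IsRepresentingMeasure (m : ℤ → ℝ) (μ : Measure ℝ) : Prop where
  finite : IsFiniteMeasure μ
  support : ∃ a b : ℝ, a ≤ b ∧ μ.support ⊆ Set.Icc a b
  moment : ∀ k : ℤ, m k = ∫ x, x ^ k.natAbs ∂μ

open Classical in
/-- The representing measure of a moment sequence (and `0` for other sequences). -/
def representingMeasure (m : ℤ → ℝ) : Measure ℝ :=
  if h : ∃ μ, IsRepresentingMeasure m μ then h.choose else 0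

/-- The sequences with a representing measure supported on `[a, b]`. -/
def momentSpace (a b : ℝ) : Set (ℤ → ℝ) :=
  {m | ∃ μ, IsRepresentingMeasure m μ ∧ μ.support ⊆ Set.Icc a b}

/-- The square summable `[-1+δ, 1-δ]`-moment sequences. -/
def momentSpaceL2 (δ : ℝ) : Set (ℤ → ℝ) :=
  {m | m ∈ momentSpace (-1 + δ) (1 - δ) ∧ Summable fun k => m k ^ 2}

/-- `m` minimises `∑ₖ (r(k) - m(k))²` over the square summable `[-1+δ, 1-δ]`-moment sequences. -/
def IsMomentLSE (δ : ℝ) (r m : ℤ → ℝ) : Prop :=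
  m ∈ momentSpaceL2 δ ∧
    ∀ m' ∈ momentSpaceL2 δ, ∑' k, (r k - m k) ^ 2 ≤ ∑' k, (r k - m' k) ^ 2

open Classical in
/-- The moment least squares estimate `Π_δ(r)` (and `0` if there is no minimiser). -/
def momentLSE (δ : ℝ) (r : ℤ → ℝ) : ℤ → ℝ :=
  if h : ∃ m, IsMomentLSE δ r m then h.choose else 0

/-- Vague convergence: `∫ f dν_n → ∫ f dν` for all continuous `f` vanishing at infinity. -/
def VaguelyTendsto (ν : ℕ → Measure ℝ) (ν' : Measure ℝ) : Prop :=
  ∀ f : C₀(ℝ, ℝ), Tendsto (fun n => ∫ x, f x ∂(ν n)) atTop (𝓝 (∫ x, f x ∂ν'))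

end MomentLS

end

/-!
By reversibility, `Q` acts on `L²(π)` as a self-adjoint contraction `T`, and
`γ(k) = ⟪G, T^|k| G⟫` with `G` the centred `g`. Hence the functional `x ^ n ↦ γ(n)` is nonnegative
on polynomials that are nonnegative on `[-1, 1]`, and such functionals are exactly the moment
functionals of finite measures on `[-1, 1]` (Riesz–Haviland): density of the polynomials in
`C([-1, 1])` extends the functional, and the Riesz–Markov theorem represents the extension.

The same positivity criterion shows that the moment sequences on `[-1 + δ, 1 - δ]` form a closed
convex subset of `ℓ²(ℤ)`, so that the projection `v` of `r_M` exists and is unique. The estimators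
`r_M` need not converge to `γ` in `ℓ²(ℤ)`, but the obtuse angle property gives
`‖v - γ‖² ≤ ⟪r_M - γ, v - γ⟫`, where `r_M - γ` is only tested against a sequence bounded by a
multiple of `q ^ |k|` with `q < 1`. As `|r_M(k)| ≤ r_M(0)`, dominated convergence makes the right
hand side small. Convergence of moments on a common compact interval then yields convergence of the
integrals of all continuous functions, by polynomial approximation.
-/

namespace MomentLS

open scoped Polynomial InnerProductSpace lp

section ConvexProjection

variable {E : Type*} [NormedAddCommGroup E] [InnerProductSpace ℝ E] {K : Set E} {x v c : E}

theorem inner_sub_sub_nonpos_of_isMinOn (hK : Convex ℝ K) (hv : v ∈ K)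
    (hmin : IsMinOn (fun w => ‖x - w‖) K v) (hc : c ∈ K) : ⟪x - v, c - v⟫_ℝ ≤ 0 := by
  have : Nonempty K := ⟨⟨v, hv⟩⟩
  have hbdd : BddBelow (range fun w : K => ‖x - w‖) :=
    ⟨0, forall_mem_range.2 fun _ => norm_nonneg _⟩
  have hinf : ‖x - v‖ = ⨅ w : K, ‖x - w‖ :=
    le_antisymm (le_ciInf fun w => hmin w.2) (ciInf_le hbdd ⟨v, hv⟩)
  exact (norm_eq_iInf_iff_real_inner_le_zero hK hv).1 hinf c hc

theorem norm_sub_sq_le_inner_of_isMinOn (hK : Convex ℝ K) (hv : v ∈ K)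
    (hmin : IsMinOn (fun w => ‖x - w‖) K v) (hc : c ∈ K) :
    ‖v - c‖ ^ 2 ≤ ⟪x - c, v - c⟫_ℝ := by
  have hobtuse := inner_sub_sub_nonpos_of_isMinOn hK hv hmin hc
  calc ‖v - c‖ ^ 2 = ⟪(x - c) - (x - v), v - c⟫_ℝ := by
        rw [sub_sub_sub_cancel_left, real_inner_self_eq_norm_sq]
    _ = ⟪x - c, v - c⟫_ℝ + ⟪x - v, c - v⟫_ℝ := by
        rw [inner_sub_left, ← neg_sub v c, inner_neg_right, sub_eq_add_neg]
    _ ≤ ⟪x - c, v - c⟫_ℝ := add_le_of_nonpos_right hobtuse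

theorem existsUnique_isMinOn_norm_sub (hne : K.Nonempty) (hcomplete : IsComplete K)
    (hK : Convex ℝ K) (x : E) : ∃! v, v ∈ K ∧ IsMinOn (fun w => ‖x - w‖) K v := by
  obtain ⟨v, hv, hinf⟩ := exists_norm_eq_iInf_of_complete_convex hne hcomplete hK x
  have hbdd : BddBelow (range fun w : K => ‖x - w‖) :=
    ⟨0, forall_mem_range.2 fun _ => norm_nonneg _⟩
  have hmin : IsMinOn (fun w => ‖x - w‖) K v := fun w hw => hinf.trans_le (ciInf_le hbdd ⟨w, hw⟩)
  refine ⟨v, ⟨hv, hmin⟩, fun w ⟨hw, hwmin⟩ => sub_eq_zero.1 (norm_eq_zero.1 ?_)⟩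
  have hsq : ‖w - v‖ ^ 2 ≤ 0 :=
    (norm_sub_sq_le_inner_of_isMinOn hK hw hwmin hv).trans
      (inner_sub_sub_nonpos_of_isMinOn hK hv hmin hw)
  exact sq_eq_zero_iff.1 (hsq.antisymm (sq_nonneg _))

end ConvexProjection

section RieszMarkov

variable {X : Type*} [TopologicalSpace X] [CompactSpace X]

theorem nonneg_of_abs_apply_le {Λ : C(X, ℝ) →ₗ[ℝ] ℝ} (hΛ : ∀ f, |Λ f| ≤ Λ 1 * ‖f‖)
    {f : C(X, ℝ)} (hf : 0 ≤ f) : 0 ≤ Λ f := by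
  have hone : 0 ≤ Λ 1 := by
    by_contra! h
    nlinarith [hΛ 1, abs_pos_of_neg h, norm_nonneg (1 : C(X, ℝ))]
  have hcompl : ‖‖f‖ • 1 - f‖ ≤ ‖f‖ := by
    refine (ContinuousMap.norm_le _ (norm_nonneg f)).2 fun x => ?_
    have hx : f x ≤ ‖f‖ := (le_abs_self _).trans (f.norm_coe_le_norm x)
    have hfx : 0 ≤ f x := hf x
    simpa [abs_of_nonneg (sub_nonneg.2 hx)] using hfx
  have hle : Λ (‖f‖ • 1 - f) ≤ ‖f‖ * Λ 1 :=
    calc Λ (‖f‖ • 1 - f) ≤ Λ 1 * ‖‖f‖ • 1 - f‖ := (le_abs_self _).trans (hΛ _)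
      _ ≤ Λ 1 * ‖f‖ := by gcongr
      _ = ‖f‖ * Λ 1 := mul_comm _ _
  rw [map_sub, map_smul, smul_eq_mul] at hle
  linarith

theorem exists_forall_eq_integral_of_nonneg [T2Space X] [MeasurableSpace X] [BorelSpace X]
    {Λ : C(X, ℝ) →ₗ[ℝ] ℝ} (hΛ : ∀ f, 0 ≤ f → 0 ≤ Λ f) :
    ∃ μ : Measure X, IsFiniteMeasure μ ∧ ∀ f, Λ f = ∫ x, f x ∂μ := by
  let toContinuous : CompactlySupportedContinuousMap X ℝ →ₗ[ℝ] C(X, ℝ) :=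
    { toFun := fun f => f.toContinuousMap
      map_add' := fun _ _ => rfl
      map_smul' := fun _ _ => rfl }
  let Λc : CompactlySupportedContinuousMap X ℝ →ₚ[ℝ] ℝ :=
    PositiveLinearMap.mk₀ (Λ ∘ₗ toContinuous) fun f hf => hΛ _ fun x => hf x
  exact ⟨RealRMK.rieszMeasure Λc, inferInstance, fun f => (RealRMK.integral_rieszMeasure Λc
    (CompactlySupportedContinuousMap.continuousMapEquiv f)).symm⟩

end RieszMarkov

section RieszHaviland

variable {K : Set ℝ} {L : ℝ[X] →ₗ[ℝ] ℝ}

theorem denseRange_toContinuousMapOn (K : Set ℝ) [CompactSpace K] :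
    DenseRange fun p : ℝ[X] => p.toContinuousMapOn K := by
  have hrange : range (fun p : ℝ[X] => p.toContinuousMapOn K) = polynomialFunctions K :=
    (polynomialFunctions_coe K).symm
  rw [DenseRange, dense_iff_closure_eq, hrange, ← Subalgebra.topologicalClosure_coe,
    polynomialFunctions.topologicalClosure K, Algebra.coe_top]

theorem abs_apply_le_mul_norm_toContinuousMapOn [CompactSpace K]
    (hL : ∀ p : ℝ[X], (∀ x ∈ K, 0 ≤ p.eval x) → 0 ≤ L p) (p : ℝ[X]) :
    |L p| ≤ L 1 * ‖p.toContinuousMapOn K‖ := by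
  set C := ‖p.toContinuousMapOn K‖
  have hbound : ∀ x ∈ K, |p.eval x| ≤ C := fun x hx =>
    (p.toContinuousMapOn K).norm_coe_le_norm ⟨x, hx⟩
  have hsub := hL (C • 1 - p) fun x hx => by simpa using (abs_le.1 (hbound x hx)).2
  have hadd := hL (p + C • 1) fun x hx => by
    simpa using neg_le_iff_add_nonneg.1 (abs_le.1 (hbound x hx)).1
  rw [map_sub, map_smul, smul_eq_mul] at hsub
  rw [map_add, map_smul, smul_eq_mul] at hadd
  exact abs_le.2 ⟨by linarith, by linarith⟩

theorem exists_extension_of_nonneg [CompactSpace K]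
    (hL : ∀ p : ℝ[X], (∀ x ∈ K, 0 ≤ p.eval x) → 0 ≤ L p) :
    ∃ Λ : C(K, ℝ) →ₗ[ℝ] ℝ, (∀ f, 0 ≤ f → 0 ≤ Λ f) ∧
      ∀ p : ℝ[X], Λ (p.toContinuousMapOn K) = L p := by
  let e : ℝ[X] →ₗ[ℝ] C(K, ℝ) := (Polynomial.toContinuousMapOnAlgHom K).toLinearMap
  have hdense : DenseRange e := denseRange_toContinuousMapOn K
  have hbound : ∀ p, ‖L p‖ ≤ L 1 * ‖e p‖ := abs_apply_le_mul_norm_toContinuousMapOn hL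
  have hΛ : ∀ p, L.extendOfNorm e (e p) = L p :=
    LinearMap.extendOfNorm_eq hdense ⟨L 1, hbound⟩
  have hΛ_one : L.extendOfNorm e 1 = L 1 :=
    (congrArg _ (map_one (Polynomial.toContinuousMapOnAlgHom K)).symm).trans (hΛ 1)
  refine ⟨(L.extendOfNorm e : C(K, ℝ) →ₗ[ℝ] ℝ), fun f => nonneg_of_abs_apply_le fun f => ?_, hΛ⟩
  rw [ContinuousLinearMap.coe_coe, hΛ_one]
  exact LinearMap.norm_extendOfNorm_apply_le hdense (L 1) hbound f

theorem exists_measure_of_nonneg [CompactSpace K]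
    (hL : ∀ p : ℝ[X], (∀ x ∈ K, 0 ≤ p.eval x) → 0 ≤ L p) :
    ∃ μ : Measure ℝ, IsFiniteMeasure μ ∧ μ.support ⊆ K ∧
      ∀ p : ℝ[X], L p = ∫ x, p.eval x ∂μ := by
  have hK : IsClosed K := (isCompact_iff_compactSpace.2 inferInstance).isClosed
  obtain ⟨Λ, hΛ_nonneg, hΛ⟩ := exists_extension_of_nonneg hL
  obtain ⟨ν, hν, hΛν⟩ := exists_forall_eq_integral_of_nonneg hΛ_nonneg
  refine ⟨ν.map (↑), inferInstance, Measure.support_subset_of_isClosed hK ?_, fun p => ?_⟩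
  · rw [mem_ae_map_iff measurable_subtype_coe.aemeasurable hK.measurableSet]
    simp
  · rw [integral_map measurable_subtype_coe.aemeasurable (by fun_prop), ← hΛ]
    exact hΛν (p.toContinuousMapOn K)

end RieszHaviland

section CompactSupport

variable {X : Type*} [TopologicalSpace X] [HereditarilyLindelofSpace X] [MeasurableSpace X]
  {μ : Measure X} {K : Set X}

theorem ae_mem_of_support_subset (hμ : μ.support ⊆ K) : ∀ᵐ x ∂μ, x ∈ K :=
  Filter.mem_of_superset Measure.support_mem_ae hμ

theorem integrable_of_continuous_of_support_subset [OpensMeasurableSpace X] [IsFiniteMeasure μ]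
    (hK : IsCompact K) (hμ : μ.support ⊆ K) {f : X → ℝ} (hf : Continuous f) :
    Integrable f μ := by
  obtain ⟨C, hC⟩ := hK.exists_bound_of_continuousOn hf.continuousOn
  exact .of_bound hf.aestronglyMeasurable C ((ae_mem_of_support_subset hμ).mono hC)

theorem abs_integral_sub_integral_le [OpensMeasurableSpace X] [IsFiniteMeasure μ]
    (hK : IsCompact K) (hμ : μ.support ⊆ K) {f g : X → ℝ} (hf : Continuous f)
    (hg : Continuous g) {ε : ℝ} (hfg : ∀ x ∈ K, |f x - g x| ≤ ε) :
    |∫ x, f x ∂μ - ∫ x, g x ∂μ| ≤ ε * μ.real univ := by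
  rw [← integral_sub (integrable_of_continuous_of_support_subset hK hμ hf)
    (integrable_of_continuous_of_support_subset hK hμ hg), ← Real.norm_eq_abs]
  exact norm_integral_le_of_norm_le_const ((ae_mem_of_support_subset hμ).mono hfg)

end CompactSupport

section MomentSpace

variable {m : ℤ → ℝ} {μ : Measure ℝ} {a b : ℝ}

/-- The Riesz functional `X ^ n ↦ m n` on real polynomials, linear also in the sequence `m`,
of which only the terms of nonnegative index matter. -/
noncomputable def momentFunctional : (ℤ → ℝ) →ₗ[ℝ] ℝ[X] →ₗ[ℝ] ℝ :=
  ((Polynomial.basisMonomials ℝ).constr ℝ).toLinearMap ∘ₗ LinearMap.funLeft ℝ ℝ ((↑) : ℕ → ℤ)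

theorem momentFunctional_apply (m : ℤ → ℝ) (p : ℝ[X]) :
    momentFunctional m p = p.sum fun n c => c * m n :=
  (Polynomial.basisMonomials ℝ).constr_apply ℝ _ p

theorem momentFunctional_monomial (m : ℤ → ℝ) (n : ℕ) (c : ℝ) :
    momentFunctional m (Polynomial.monomial n c) = c * m n := by
  rw [momentFunctional_apply, Polynomial.sum_monomial_index c _ (zero_mul (m n))]

theorem continuous_momentFunctional (p : ℝ[X]) :
    Continuous fun m : ℤ → ℝ => momentFunctional m p := by
  simp only [momentFunctional_apply, Polynomial.sum]
  fun_prop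

namespace IsRepresentingMeasure

theorem momentFunctional_eq_integral (hμ : IsRepresentingMeasure m μ) (p : ℝ[X]) :
    momentFunctional m p = ∫ x, p.eval x ∂μ := by
  have := hμ.finite
  obtain ⟨a, b, -, hab⟩ := hμ.support
  have hint : ∀ p : ℝ[X], Integrable (fun x => p.eval x) μ := fun p =>
    integrable_of_continuous_of_support_subset isCompact_Icc hab p.continuous
  induction p using Polynomial.induction_on' with
  | add p q hp hq =>
    simp only [map_add, hp, hq, Polynomial.eval_add]
    rw [integral_add (hint p) (hint q)]
  | monomial n c =>
    simp only [momentFunctional_monomial, Polynomial.eval_monomial]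
    rw [integral_const_mul, hμ.moment, Int.natAbs_natCast]

theorem apply_zero (hμ : IsRepresentingMeasure m μ) : m 0 = μ.real univ := by
  rw [hμ.moment]
  simp

theorem apply_zero_nonneg (hμ : IsRepresentingMeasure m μ) : 0 ≤ m 0 :=
  hμ.apply_zero ▸ measureReal_nonneg

end IsRepresentingMeasure

theorem mem_momentSpace_iff :
    m ∈ momentSpace a b ↔ (∀ k : ℤ, m k = m k.natAbs) ∧
      ∀ p : ℝ[X], (∀ x ∈ Icc a b, 0 ≤ p.eval x) → 0 ≤ momentFunctional m p := by
  constructor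
  · rintro ⟨μ, hμ, hsupp⟩
    refine ⟨fun k => by rw [hμ.moment, hμ.moment, Int.natAbs_natCast], fun p hp => ?_⟩
    rw [hμ.momentFunctional_eq_integral]
    exact integral_nonneg_of_ae ((ae_mem_of_support_subset hsupp).mono hp)
  · rintro ⟨heven, hnonneg⟩
    obtain ⟨μ, hfin, hsupp, hμ⟩ := exists_measure_of_nonneg hnonneg
    refine ⟨μ, ⟨hfin, ?_, fun k => ?_⟩, hsupp⟩
    · exact ⟨min a b, b, min_le_right a b, hsupp.trans (Icc_subset_Icc_left (min_le_left a b))⟩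
    · have hk := hμ (Polynomial.monomial k.natAbs 1)
      simpa only [momentFunctional_monomial, Polynomial.eval_monomial, one_mul, ← heven] using hk

theorem isClosed_momentSpace (a b : ℝ) : IsClosed (momentSpace a b) := by
  have heq : momentSpace a b = (⋂ k : ℤ, {m | m k = m k.natAbs}) ∩
      ⋂ (p : ℝ[X]) (_ : ∀ x ∈ Icc a b, 0 ≤ p.eval x), {m | 0 ≤ momentFunctional m p} := by
    ext m
    simp [mem_momentSpace_iff]
  rw [heq]
  exact (isClosed_iInter fun k => isClosed_eq (continuous_apply k)
    (continuous_apply (k.natAbs : ℤ))).inter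
    <| isClosed_iInter fun p => isClosed_iInter fun _ =>
      isClosed_le continuous_const (continuous_momentFunctional p)

theorem convex_momentSpace (a b : ℝ) : Convex ℝ (momentSpace a b) := by
  intro m hm m' hm' s t hs ht _
  rw [mem_momentSpace_iff] at hm hm' ⊢
  refine ⟨fun k => ?_, fun p hp => ?_⟩
  · simp only [Pi.add_apply, Pi.smul_apply, ← hm.1 k, ← hm'.1 k]
  · simp only [map_add, map_smul, LinearMap.add_apply, LinearMap.smul_apply, smul_eq_mul]
    exact add_nonneg (mul_nonneg hs (hm.2 p hp)) (mul_nonneg ht (hm'.2 p hp))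

theorem zero_mem_momentSpace (a b : ℝ) : (0 : ℤ → ℝ) ∈ momentSpace a b :=
  mem_momentSpace_iff.2 ⟨fun _ => rfl, fun p _ => by rw [map_zero, LinearMap.zero_apply]⟩

theorem apply_zero_nonneg_of_mem_momentSpace (hm : m ∈ momentSpace a b) : 0 ≤ m 0 :=
  let ⟨_, hμ, _⟩ := hm
  hμ.apply_zero_nonneg

theorem abs_apply_le_of_mem_momentSpace {q : ℝ} (hq : Icc a b ⊆ Icc (-q) q)
    (hm : m ∈ momentSpace a b) (k : ℤ) : |m k| ≤ m 0 * q ^ k.natAbs := by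
  obtain ⟨μ, hμ, hsupp⟩ := hm
  have := hμ.finite
  have hpow : ∀ᵐ x ∂μ, ‖x ^ k.natAbs‖ ≤ q ^ k.natAbs := by
    filter_upwards [ae_mem_of_support_subset hsupp] with x hx
    rw [norm_pow, Real.norm_eq_abs]
    exact pow_le_pow_left₀ (abs_nonneg x) (abs_le.2 (hq hx)) _
  rw [hμ.apply_zero, hμ.moment, mul_comm, ← Real.norm_eq_abs]
  exact norm_integral_le_of_norm_le_const hpow

end MomentSpace

section MethodOfMoments

variable {m : ℤ → ℝ} {μ ν : Measure ℝ} {a b : ℝ}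

theorem abs_integral_sub_momentFunctional_le (hμ : IsRepresentingMeasure m μ)
    (hsupp : μ.support ⊆ Icc a b) {f : ℝ → ℝ} (hf : Continuous f) {p : ℝ[X]} {ε : ℝ}
    (hp : ∀ x ∈ Icc a b, |f x - p.eval x| ≤ ε) :
    |∫ x, f x ∂μ - momentFunctional m p| ≤ ε * m 0 := by
  have := hμ.finite
  rw [hμ.momentFunctional_eq_integral, hμ.apply_zero]
  exact abs_integral_sub_integral_le isCompact_Icc hsupp hf p.continuous hp

theorem tendsto_integral_of_tendsto_moments {ι : Type*} {l : Filter ι} {m : ι → ℤ → ℝ}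
    {m' : ℤ → ℝ} {μ : ι → Measure ℝ} (hμ : ∀ i, IsRepresentingMeasure (m i) (μ i))
    (hν : IsRepresentingMeasure m' ν) (hμ_supp : ∀ i, (μ i).support ⊆ Icc a b)
    (hν_supp : ν.support ⊆ Icc a b) (hm : Tendsto m l (𝓝 m')) {f : ℝ → ℝ} (hf : Continuous f) :
    Tendsto (fun i => ∫ x, f x ∂(μ i)) l (𝓝 (∫ x, f x ∂ν)) := by
  refine Metric.tendsto_nhds.2 fun ε hε => ?_
  obtain ⟨η, hη, hη_lt⟩ := exists_pos_mul_lt hε (2 * m' 0)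
  obtain ⟨p, hp⟩ := exists_polynomial_near_of_continuousOn a b f hf.continuousOn η hη
  have hfp : ∀ x ∈ Icc a b, |f x - p.eval x| ≤ η := fun x hx => by
    rw [abs_sub_comm]
    exact (hp x hx).le
  have hp_lim := ((continuous_momentFunctional p).tendsto m').comp hm
  have hbound : Tendsto
      (fun i => η * m i 0 + dist (momentFunctional (m i) p) (momentFunctional m' p) + η * m' 0) l
      (𝓝 (η * m' 0 + 0 + η * m' 0)) :=
    (((tendsto_pi_nhds.1 hm 0).const_mul η).add
      (tendsto_iff_dist_tendsto_zero.1 hp_lim)).add_const _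
  filter_upwards [hbound.eventually_lt_const (u := ε) (by linarith)] with i hi
  calc dist (∫ x, f x ∂μ i) (∫ x, f x ∂ν)
      ≤ dist (∫ x, f x ∂μ i) (momentFunctional (m i) p) +
        dist (momentFunctional (m i) p) (momentFunctional m' p) +
        dist (momentFunctional m' p) (∫ x, f x ∂ν) := dist_triangle4 _ _ _ _
    _ ≤ η * m i 0 + dist (momentFunctional (m i) p) (momentFunctional m' p) + η * m' 0 := by
      gcongr
      · exact abs_integral_sub_momentFunctional_le (hμ i) (hμ_supp i) hf hfp
      · rw [dist_comm]
        exact abs_integral_sub_momentFunctional_le hν hν_supp hf hfp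
    _ < ε := hi

theorem IsRepresentingMeasure.unique (hμ : IsRepresentingMeasure m μ)
    (hν : IsRepresentingMeasure m ν) : μ = ν := by
  have := hμ.finite
  have := hν.finite
  obtain ⟨a, b, -, hab⟩ := hμ.support
  obtain ⟨c, d, -, hcd⟩ := hν.support
  have hμ_supp : μ.support ⊆ Icc (min a c) (max b d) :=
    hab.trans (Icc_subset_Icc (min_le_left a c) (le_max_left b d))
  have hν_supp : ν.support ⊆ Icc (min a c) (max b d) :=
    hcd.trans (Icc_subset_Icc (min_le_right a c) (le_max_right b d))
  refine ext_of_forall_integral_eq_of_IsFiniteMeasure fun f => ?_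
  exact tendsto_nhds_unique (tendsto_const_nhds (f := (atTop : Filter ℕ)))
    (tendsto_integral_of_tendsto_moments (fun _ => hμ) hν (fun _ => hμ_supp) hν_supp
      tendsto_const_nhds f.continuous)

theorem IsRepresentingMeasure.representingMeasure_eq (hμ : IsRepresentingMeasure m μ) :
    representingMeasure m = μ := by
  have hex : ∃ μ, IsRepresentingMeasure m μ := ⟨μ, hμ⟩
  rw [representingMeasure, dif_pos hex]
  exact hex.choose_spec.unique hμ

theorem existsUnique_isRepresentingMeasure (hm : m ∈ momentSpace a b) :
    ∃! μ, IsRepresentingMeasure m μ :=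
  let ⟨μ, hμ, _⟩ := hm
  ⟨μ, hμ, fun _ hν => hν.unique hμ⟩

theorem isRepresentingMeasure_representingMeasure (hm : m ∈ momentSpace a b) :
    IsRepresentingMeasure m (representingMeasure m) :=
  let ⟨_, hμ, _⟩ := hm
  hμ.representingMeasure_eq.symm ▸ hμ

theorem support_representingMeasure_subset (hm : m ∈ momentSpace a b) :
    (representingMeasure m).support ⊆ Icc a b :=
  let ⟨_, hμ, hsupp⟩ := hm
  hμ.representingMeasure_eq.symm ▸ hsupp

theorem vaguelyTendsto_representingMeasure {m : ℕ → ℤ → ℝ} {m' : ℤ → ℝ}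
    (hm : ∀ n, m n ∈ momentSpace a b) (hm' : m' ∈ momentSpace a b)
    (hlim : Tendsto m atTop (𝓝 m')) :
    VaguelyTendsto (fun n => representingMeasure (m n)) (representingMeasure m') := fun f =>
  tendsto_integral_of_tendsto_moments (fun n => isRepresentingMeasure_representingMeasure (hm n))
    (isRepresentingMeasure_representingMeasure hm')
    (fun n => support_representingMeasure_subset (hm n))
    (support_representingMeasure_subset hm') hlim f.continuous

end MethodOfMoments

section SquareSummable

variable {ι : Type*}

theorem memℓp_two_iff_summable_sq {u : ι → ℝ} : Memℓp u 2 ↔ Summable fun j => u j ^ 2 := by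
  rw [memℓp_gen_iff (by norm_num)]
  simp

theorem norm_sq_eq_tsum (x : ℓ²(ι, ℝ)) : ‖x‖ ^ 2 = ∑' j, x j ^ 2 := by
  rw [← real_inner_self_eq_norm_sq, lp.inner_eq_tsum]
  simp [sq]

theorem inner_le_mul_tsum_abs_mul {w : ι → ℝ} (hw : Summable w) {x u : ℓ²(ι, ℝ)} {B : ℝ}
    (hu : ∀ j, |u j| ≤ B * w j) : ⟪x, u⟫_ℝ ≤ B * ∑' j, |x j| * w j := by
  have hsum : Summable fun j => |x j| * w j :=
    .of_norm_bounded (hw.norm.mul_left ‖x‖) fun j => by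
      rw [norm_mul, Real.norm_eq_abs, abs_abs, ← Real.norm_eq_abs]
      gcongr
      exact lp.norm_apply_le_norm two_ne_zero x j
  rw [lp.inner_eq_tsum, ← tsum_mul_left]
  refine (lp.summable_inner x u).tsum_le_tsum (fun j => ?_) (hsum.mul_left B)
  calc ⟪x j, u j⟫_ℝ ≤ |x j| * |u j| := real_inner_le_norm _ _
    _ ≤ |x j| * (B * w j) := by gcongr; exact hu j
    _ = B * (|x j| * w j) := mul_left_comm _ _ _

theorem tendsto_tsum_mul_of_abs_le {α : Type*} {l : Filter α} {u : α → ι → ℝ} {v w : ι → ℝ}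
    {B : α → ℝ} {B₀ : ℝ} (hw : Summable w) (hu : ∀ j, Tendsto (fun i => u i j) l (𝓝 (v j)))
    (hB : Tendsto B l (𝓝 B₀)) (hbound : ∀ i j, |u i j| ≤ B i) :
    Tendsto (fun i => ∑' j, u i j * w j) l (𝓝 (∑' j, v j * w j)) := by
  refine tendsto_tsum_of_dominated_convergence (hw.norm.mul_left (B₀ + 1))
    (fun j => (hu j).mul_const _) ?_
  filter_upwards [hB.eventually_le_const (lt_add_one B₀)] with i hi j
  rw [norm_mul]
  gcongr
  exact (hbound i j).trans hi

theorem summable_pow_natAbs {q : ℝ} (hq : q ∈ Ico 0 1) : Summable fun k : ℤ => q ^ k.natAbs := by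
  have hgeom := summable_geometric_of_lt_one hq.1 hq.2
  exact .of_nat_of_neg (by simpa using hgeom) (by simpa using hgeom)

theorem summable_sq_of_even_of_eventually_zero {u : ℤ → ℝ} (heven : ∀ k, u k = u (-k)) {n : ℕ}
    (hn : ∀ k : ℤ, (n : ℤ) ≤ k → u k = 0) : Summable fun k => u k ^ 2 := by
  refine summable_of_ne_finset_zero (s := Finset.Ioo (-n : ℤ) n) fun k hk => ?_
  have huk : u k = 0 := by
    rw [Finset.mem_Ioo, not_and_or, not_lt, not_lt] at hk
    rcases hk with hk | hk
    · rw [heven, hn (-k) (by lia)]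
    · exact hn k hk
  rw [huk, sq, zero_mul]

end SquareSummable

section MomentCone

variable {a b q : ℝ}

/-- The sequences with a representing measure on `[a, b]`, as a subset of the Hilbert space
`ℓ²(ℤ, ℝ)`. -/
def momentCone (a b : ℝ) : Set ℓ²(ℤ, ℝ) :=
  {x | ⇑x ∈ momentSpace a b}

theorem zero_mem_momentCone (a b : ℝ) : 0 ∈ momentCone a b :=
  zero_mem_momentSpace a b

theorem convex_momentCone (a b : ℝ) : Convex ℝ (momentCone a b) :=
  fun _ hx _ hy _ _ hs ht hst => convex_momentSpace a b hx hy hs ht hst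

theorem isClosed_momentCone (a b : ℝ) : IsClosed (momentCone a b) :=
  (isClosed_momentSpace a b).preimage lp.uniformContinuous_coe.continuous

theorem mem_momentSpaceL2_iff {δ : ℝ} {m : ℤ → ℝ} :
    m ∈ momentSpaceL2 δ ↔ ∃ x ∈ momentCone (-1 + δ) (1 - δ), ⇑x = m := by
  constructor
  · rintro ⟨hm, hsum⟩
    exact ⟨⟨m, memℓp_two_iff_summable_sq.2 hsum⟩, hm, rfl⟩
  · rintro ⟨x, hx, rfl⟩
    exact ⟨hx, memℓp_two_iff_summable_sq.1 (lp.memℓp x)⟩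

theorem summable_sq_of_mem_momentSpace (hq : q ∈ Ico 0 1) (hab : Icc a b ⊆ Icc (-q) q)
    {m : ℤ → ℝ} (hm : m ∈ momentSpace a b) : Summable fun k => m k ^ 2 := by
  refine .of_nonneg_of_le (fun k => sq_nonneg (m k)) (fun k => ?_)
    ((summable_pow_natAbs hq).mul_left (m 0 ^ 2))
  have hpow_nonneg : 0 ≤ q ^ k.natAbs := pow_nonneg hq.1 _
  calc m k ^ 2 = |m k| ^ 2 := (sq_abs _).symm
    _ ≤ (m 0 * q ^ k.natAbs) ^ 2 := by gcongr; exact abs_apply_le_of_mem_momentSpace hab hm k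
    _ = m 0 ^ 2 * (q ^ k.natAbs) ^ 2 := mul_pow _ _ _
    _ ≤ m 0 ^ 2 * q ^ k.natAbs := by
      gcongr
      exact pow_le_of_le_one hpow_nonneg (pow_le_one₀ hq.1 hq.2.le) two_ne_zero

variable {x v c : ℓ²(ℤ, ℝ)}

-- Comparing the projection with the zero sequence bounds the total mass `v 0` of its measure.
theorem apply_zero_le_of_isMinOn_momentCone (hq : q ∈ Ico 0 1) (hab : Icc a b ⊆ Icc (-q) q)
    (hv : v ∈ momentCone a b) (hmin : IsMinOn (fun w => ‖x - w‖) (momentCone a b) v) :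
    v 0 ≤ ∑' j : ℤ, |x j| * q ^ j.natAbs := by
  set T := ∑' j : ℤ, |x j| * q ^ j.natAbs
  have hT : 0 ≤ T := tsum_nonneg fun j => mul_nonneg (abs_nonneg _) (pow_nonneg hq.1 _)
  have hv_nonneg : 0 ≤ v 0 := apply_zero_nonneg_of_mem_momentSpace hv
  have hsq : v 0 * v 0 ≤ v 0 * T :=
    calc v 0 * v 0 ≤ ‖v‖ * ‖v‖ := by
          gcongr <;> exact (le_abs_self _).trans (lp.norm_apply_le_norm two_ne_zero v 0)
      _ = ‖v - 0‖ ^ 2 := by rw [sub_zero, sq]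
      _ ≤ ⟪x - 0, v - 0⟫_ℝ := norm_sub_sq_le_inner_of_isMinOn (convex_momentCone a b) hv hmin
          (zero_mem_momentCone a b)
      _ ≤ v 0 * T := by
          rw [sub_zero, sub_zero]
          exact inner_le_mul_tsum_abs_mul (summable_pow_natAbs hq)
            (abs_apply_le_of_mem_momentSpace hab hv)
  rcases hv_nonneg.eq_or_lt with hzero | hpos
  · exact hzero.symm.trans_le hT
  · exact le_of_mul_le_mul_left hsq hpos

theorem norm_sub_sq_le_of_isMinOn_momentCone (hq : q ∈ Ico 0 1) (hab : Icc a b ⊆ Icc (-q) q)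
    (hv : v ∈ momentCone a b) (hmin : IsMinOn (fun w => ‖x - w‖) (momentCone a b) v)
    (hc : c ∈ momentCone a b) :
    ‖v - c‖ ^ 2 ≤ (v 0 + c 0) * ∑' j : ℤ, |x j - c j| * q ^ j.natAbs := by
  have hbound : ∀ j, |(v - c) j| ≤ (v 0 + c 0) * q ^ j.natAbs := fun j =>
    calc |(v - c) j| ≤ |v j| + |c j| := abs_sub _ _
      _ ≤ v 0 * q ^ j.natAbs + c 0 * q ^ j.natAbs :=
        add_le_add (abs_apply_le_of_mem_momentSpace hab hv j)
          (abs_apply_le_of_mem_momentSpace hab hc j)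
      _ = (v 0 + c 0) * q ^ j.natAbs := (add_mul _ _ _).symm
  exact (norm_sub_sq_le_inner_of_isMinOn (convex_momentCone a b) hv hmin hc).trans
    (inner_le_mul_tsum_abs_mul (summable_pow_natAbs hq) hbound)

theorem tendsto_of_isMinOn_momentCone {ι : Type*} {l : Filter ι} {x v : ι → ℓ²(ℤ, ℝ)}
    (hq : q ∈ Ico 0 1) (hab : Icc a b ⊆ Icc (-q) q) (hv : ∀ i, v i ∈ momentCone a b)
    (hmin : ∀ i, IsMinOn (fun w => ‖x i - w‖) (momentCone a b) (v i)) (hc : c ∈ momentCone a b)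
    (hx : ∀ k, Tendsto (fun i => x i k) l (𝓝 (c k))) (hpeak : ∀ i k, |x i k| ≤ x i 0) :
    Tendsto v l (𝓝 c) := by
  have hsum := summable_pow_natAbs hq
  have hc_peak : ∀ k, |c k| ≤ c 0 := fun k =>
    (abs_apply_le_of_mem_momentSpace hab hc k).trans (mul_le_of_le_one_right
      (apply_zero_nonneg_of_mem_momentSpace hc) (pow_le_one₀ hq.1 hq.2.le))
  have hmass := tendsto_tsum_mul_of_abs_le hsum (fun k => (hx k).abs) (hx 0)
    fun i k => (abs_abs _).trans_le (hpeak i k)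
  have herror : Tendsto (fun i => ∑' j : ℤ, |x i j - c j| * q ^ j.natAbs) l (𝓝 0) := by
    simpa using tendsto_tsum_mul_of_abs_le hsum (fun k => ((hx k).sub_const (c k)).abs)
      ((hx 0).add_const (c 0)) fun i k =>
        (abs_abs _).trans_le ((abs_sub _ _).trans (add_le_add (hpeak i k) (hc_peak k)))
  have hsq : Tendsto (fun i => ‖v i - c‖ ^ 2) l (𝓝 0) := by
    refine squeeze_zero (fun i => sq_nonneg _) (fun i => ?_)
      (by simpa using (hmass.add_const (c 0)).mul herror)
    refine (norm_sub_sq_le_of_isMinOn_momentCone hq hab (hv i) (hmin i) hc).trans ?_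
    gcongr
    · exact tsum_nonneg fun j => mul_nonneg (abs_nonneg _) (pow_nonneg hq.1 _)
    · exact apply_zero_le_of_isMinOn_momentCone hq hab (hv i) (hmin i)
  refine tendsto_iff_norm_sub_tendsto_zero.2 ?_
  simpa using hsq.sqrt

end MomentCone

section MomentLSE

variable {δ : ℝ}

theorem isMomentLSE_coe_iff {x v : ℓ²(ℤ, ℝ)} :
    IsMomentLSE δ x v ↔ v ∈ momentCone (-1 + δ) (1 - δ) ∧
      IsMinOn (fun w => ‖x - w‖) (momentCone (-1 + δ) (1 - δ)) v := by
  have hdist : ∀ w : ℓ²(ℤ, ℝ), ∑' k, (x k - w k) ^ 2 = ‖x - w‖ ^ 2 := fun w =>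
    (norm_sq_eq_tsum (x - w)).symm
  have hmem : ∀ w : ℓ²(ℤ, ℝ), ⇑w ∈ momentSpaceL2 δ ↔ w ∈ momentCone (-1 + δ) (1 - δ) := fun w =>
    and_iff_left (memℓp_two_iff_summable_sq.1 (lp.memℓp w))
  rw [IsMomentLSE, hmem]
  refine and_congr_right fun _ => ⟨fun h w hw => ?_, fun h m hm => ?_⟩
  · have hle := h w ((hmem w).2 hw)
    rw [hdist, hdist] at hle
    exact le_of_sq_le_sq hle (norm_nonneg _)
  · obtain ⟨w, hw, rfl⟩ := mem_momentSpaceL2_iff.1 hm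
    rw [hdist, hdist]
    exact pow_le_pow_left₀ (norm_nonneg _) (h hw) 2

theorem existsUnique_isMomentLSE (δ : ℝ) {r : ℤ → ℝ} (hr : Summable fun k => r k ^ 2) :
    ∃! m, IsMomentLSE δ r m := by
  let x : ℓ²(ℤ, ℝ) := ⟨r, memℓp_two_iff_summable_sq.2 hr⟩
  obtain ⟨v, hv, hunique⟩ := existsUnique_isMinOn_norm_sub ⟨0, zero_mem_momentCone (-1 + δ) (1 - δ)⟩
    (isClosed_momentCone _ _).isComplete (convex_momentCone _ _) x
  refine ⟨v, (isMomentLSE_coe_iff (x := x)).2 hv, fun m hm => ?_⟩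
  obtain ⟨w, _, rfl⟩ := mem_momentSpaceL2_iff.1 hm.1
  rw [hunique w ((isMomentLSE_coe_iff (x := x)).1 hm)]

theorem isMomentLSE_momentLSE (δ : ℝ) {r : ℤ → ℝ} (hr : Summable fun k => r k ^ 2) :
    IsMomentLSE δ r (momentLSE δ r) := by
  have hex := (existsUnique_isMomentLSE δ hr).exists
  rw [momentLSE, dif_pos hex]
  exact hex.choose_spec

theorem exists_Icc_subset_Icc_neg (hδ : 0 < δ) :
    ∃ q ∈ Ico (0 : ℝ) 1, Icc (-1 + δ) (1 - δ) ⊆ Icc (-q) q := by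
  refine ⟨max (1 - δ) 0, ⟨le_max_right _ _, max_lt (by linarith) one_pos⟩,
    Icc_subset_Icc ?_ (le_max_left _ _)⟩
  linarith [le_max_left (1 - δ) 0]

theorem tendsto_of_isMomentLSE {ι : Type*} {l : Filter ι} {r m : ι → ℤ → ℝ} {γ : ℤ → ℝ}
    (hδ : 0 < δ) (hm : ∀ i, IsMomentLSE δ (r i) (m i))
    (hγ : γ ∈ momentSpace (-1 + δ) (1 - δ)) (hr : ∀ k, Tendsto (fun i => r i k) l (𝓝 (γ k)))
    (hr_sum : ∀ i, Summable fun k => r i k ^ 2) (hr_peak : ∀ i k, |r i k| ≤ r i 0) :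
    Tendsto m l (𝓝 γ) := by
  obtain ⟨q, hq, hδq⟩ := exists_Icc_subset_Icc_neg hδ
  let x : ι → ℓ²(ℤ, ℝ) := fun i => ⟨r i, memℓp_two_iff_summable_sq.2 (hr_sum i)⟩
  let c : ℓ²(ℤ, ℝ) := ⟨γ, memℓp_two_iff_summable_sq.2 (summable_sq_of_mem_momentSpace hq hδq hγ)⟩
  choose v _ hvm using fun i => mem_momentSpaceL2_iff.1 (hm i).1
  have hv := fun i => (isMomentLSE_coe_iff (x := x i) (v := v i)).1 ((hvm i).symm ▸ hm i)
  have hlim : Tendsto v l (𝓝 c) := tendsto_of_isMinOn_momentCone hq hδq (fun i => (hv i).1)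
    (fun i => (hv i).2) hγ hr hr_peak
  have hvm_fun : (fun i => ⇑(v i)) = m := funext hvm
  exact hvm_fun ▸ (lp.uniformContinuous_coe.continuous.tendsto c).comp hlim

end MomentLSE

section SpectralMoments

variable {E : Type*} [NormedAddCommGroup E] [InnerProductSpace ℂ E] {T : E →L[ℂ] E}

theorem momentFunctional_eq_re_inner_aeval {m : ℤ → ℝ} {v : E}
    (hm : ∀ n : ℕ, m n = (⟪v, (T ^ n) v⟫_ℂ).re) (p : ℝ[X]) :
    momentFunctional m p = (⟪v, Polynomial.aeval T p v⟫_ℂ).re := by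
  induction p using Polynomial.induction_on' with
  | add p q hp hq => simp only [map_add, hp, hq, add_apply, inner_add_right, Complex.add_re]
  | monomial n c =>
    rw [momentFunctional_monomial, hm, Polynomial.aeval_monomial, ← Algebra.smul_def, smul_apply,
      inner_smul_right_eq_smul, Complex.smul_re, smul_eq_mul]

variable [CompleteSpace E]

theorem spectrum_subset_Icc_of_norm_le_one (hT : ‖T‖ ≤ 1) : spectrum ℝ T ⊆ Icc (-1) 1 := by
  intro x hx
  have hle : ‖x‖ ≤ ‖T‖ * ‖(1 : E →L[ℂ] E)‖ := spectrum.norm_le_norm_mul_of_mem hx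
  exact abs_le.1 (hle.trans (mul_le_one₀ hT (norm_nonneg _) ContinuousLinearMap.norm_id_le))

theorem aeval_nonneg_of_isSelfAdjoint (hT : IsSelfAdjoint T) {p : ℝ[X]}
    (hp : ∀ x ∈ spectrum ℝ T, 0 ≤ p.eval x) : 0 ≤ Polynomial.aeval T p := by
  rw [← cfc_polynomial p T]
  exact cfc_nonneg hp

theorem mem_momentSpace_of_isSelfAdjoint {a b : ℝ} (hT : IsSelfAdjoint T)
    (hspec : spectrum ℝ T ⊆ Icc a b) {v : E} {m : ℤ → ℝ}
    (hm : ∀ k : ℤ, m k = (⟪v, (T ^ k.natAbs) v⟫_ℂ).re) : m ∈ momentSpace a b := by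
  refine mem_momentSpace_iff.2 ⟨fun k => by rw [hm, hm, Int.natAbs_natCast], fun p hp => ?_⟩
  have hpos := aeval_nonneg_of_isSelfAdjoint hT fun x hx => hp x (hspec hx)
  rw [momentFunctional_eq_re_inner_aeval (fun n => by rw [hm, Int.natAbs_natCast])]
  exact ((ContinuousLinearMap.nonneg_iff_isPositive _).1 hpos).re_inner_nonneg_right v

end SpectralMoments

section TransitionOperator

variable {S : Type*} [MeasurableSpace S] {κ η : Kernel S S} {π : Measure S}

instance isMarkovKernel_pow [IsMarkovKernel κ] (n : ℕ) : IsMarkovKernel (κ ^ n) := by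
  induction n with
  | zero => exact inferInstanceAs (IsMarkovKernel Kernel.id)
  | succ n ih => rw [pow_succ]; exact inferInstanceAs (IsMarkovKernel ((κ ^ n) ∘ₖ κ))

theorem invariant_pow (h : κ.Invariant π) (n : ℕ) : (κ ^ n).Invariant π := by
  induction n with
  | zero => exact Measure.id_comp
  | succ n ih => rw [pow_succ]; exact ih.comp h

theorem measurePreserving_fst_compProd [SFinite π] (κ : Kernel S S) [IsMarkovKernel κ] :
    MeasurePreserving Prod.fst (π ⊗ₘ κ) π :=
  ⟨measurable_fst, Measure.fst_compProd π κ⟩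

theorem measurePreserving_snd_compProd [SFinite π] [IsSFiniteKernel κ] (h : κ.Invariant π) :
    MeasurePreserving Prod.snd (π ⊗ₘ κ) π :=
  ⟨measurable_snd, (Measure.snd_compProd π κ).trans h⟩

theorem measurePreserving_swap_compProd [IsFiniteMeasure π] [IsFiniteKernel κ]
    (h : κ.IsReversible π) :
    MeasurePreserving Prod.swap (π ⊗ₘ κ) (π ⊗ₘ κ) := by
  refine ⟨measurable_swap, Measure.ext_prod fun {s t} hs ht => ?_⟩
  rw [Measure.map_apply measurable_swap (hs.prod ht), preimage_swap_prod,
    Measure.compProd_apply_prod ht hs, Measure.compProd_apply_prod hs ht]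
  exact h ht hs

variable {𝕜 : Type*} [RCLike 𝕜] [IsFiniteMeasure π] [IsMarkovKernel κ] [IsMarkovKernel η]

variable (𝕜) in
/-- The operator `f ↦ (x ↦ ∫ f dκ(x))` on `L²(π)` of a Markov kernel `κ` leaving `π` invariant,
see `transitionOp_ae_eq`. With `p₁, p₂` the coordinates of `π ⊗ₘ κ` it is `p₁⋆ ∘ p₂`, composition
with a coordinate being an isometry into `L²(π ⊗ₘ κ)`; so no choice of representatives enters. -/
noncomputable def transitionOp (h : κ.Invariant π) : Lp 𝕜 2 π →L[𝕜] Lp 𝕜 2 π :=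
  (Lp.compMeasurePreservingₗᵢ 𝕜 Prod.fst
    (measurePreserving_fst_compProd κ)).toContinuousLinearMap.adjoint ∘L
  (Lp.compMeasurePreservingₗᵢ 𝕜 Prod.snd
    (measurePreserving_snd_compProd h)).toContinuousLinearMap

theorem inner_transitionOp (h : κ.Invariant π) (u f : Lp 𝕜 2 π) :
    ⟪u, transitionOp 𝕜 h f⟫_𝕜 =
      ⟪Lp.compMeasurePreserving Prod.fst (measurePreserving_fst_compProd κ) u,
        Lp.compMeasurePreserving Prod.snd (measurePreserving_snd_compProd h) f⟫_𝕜 := by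
  rw [transitionOp, ContinuousLinearMap.comp_apply, ContinuousLinearMap.adjoint_inner_right]
  rfl

theorem inner_transitionOp_eq_integral (h : κ.Invariant π) (u f : Lp 𝕜 2 π) :
    ⟪u, transitionOp 𝕜 h f⟫_𝕜 = ∫ p, ⟪u p.1, f p.2⟫_𝕜 ∂(π ⊗ₘ κ) := by
  rw [inner_transitionOp, L2.inner_def]
  refine integral_congr_ae ?_
  filter_upwards [Lp.coeFn_compMeasurePreserving u (measurePreserving_fst_compProd κ),
    Lp.coeFn_compMeasurePreserving f (measurePreserving_snd_compProd h)] with p hu hf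
  rw [hu, hf]
  rfl

theorem norm_transitionOp_le (h : κ.Invariant π) : ‖transitionOp 𝕜 h‖ ≤ 1 := by
  refine (ContinuousLinearMap.opNorm_comp_le _ _).trans ?_
  rw [LinearIsometryEquiv.norm_map]
  exact mul_le_one₀ (LinearIsometry.norm_toContinuousLinearMap_le _) (norm_nonneg _)
    (LinearIsometry.norm_toContinuousLinearMap_le _)

theorem isSelfAdjoint_transitionOp (h : κ.IsReversible π) :
    IsSelfAdjoint (transitionOp 𝕜 h.invariant) := by
  refine ContinuousLinearMap.isSelfAdjoint_iff_isSymmetric.2 fun f u => ?_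
  calc ⟪transitionOp 𝕜 h.invariant f, u⟫_𝕜
      = ∫ p, ⟪f p.2, u p.1⟫_𝕜 ∂(π ⊗ₘ κ) := by
        rw [← inner_conj_symm, inner_transitionOp_eq_integral, ← integral_conj]
        simp_rw [inner_conj_symm]
    _ = ∫ p, ⟪f p.1, u p.2⟫_𝕜 ∂(π ⊗ₘ κ) :=
        (measurePreserving_swap_compProd h).integral_comp' (f := MeasurableEquiv.prodComm)
          fun p => ⟪f p.1, u p.2⟫_𝕜
    _ = ⟪f, transitionOp 𝕜 h.invariant u⟫_𝕜 := (inner_transitionOp_eq_integral _ _ _).symm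

theorem integrable_comp_snd_compProd (h : κ.Invariant π) (f : Lp 𝕜 2 π) :
    Integrable (fun p : S × S => f p.2) (π ⊗ₘ κ) :=
  (measurePreserving_snd_compProd h).integrable_comp_of_integrable
    ((Lp.memLp f).integrable one_le_two)

theorem transitionOp_ae_eq (h : κ.Invariant π) (f : Lp 𝕜 2 π) :
    transitionOp 𝕜 h f =ᵐ[π] fun x => ∫ y, f y ∂(κ x) := by
  have hint := integrable_comp_snd_compProd h f
  refine Integrable.ae_eq_of_forall_setIntegral_eq _ _
    ((Lp.memLp _).integrable one_le_two) hint.integral_compProd fun s hs _ => ?_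
  calc ∫ x in s, transitionOp 𝕜 h f x ∂π
      = ⟪indicatorConstLp 2 hs (measure_ne_top π s) (1 : 𝕜), transitionOp 𝕜 h f⟫_𝕜 :=
        (L2.inner_indicatorConstLp_one hs _ _).symm
    _ = ∫ p in Prod.fst ⁻¹' s, Lp.compMeasurePreserving Prod.snd
          (measurePreserving_snd_compProd h) f p ∂(π ⊗ₘ κ) := by
        rw [inner_transitionOp, Lp.indicatorConstLp_compMeasurePreserving,
          L2.inner_indicatorConstLp_one]
    _ = ∫ p in s ×ˢ univ, f p.2 ∂(π ⊗ₘ κ) := by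
        rw [← prod_univ]
        exact setIntegral_congr_ae (hs.prod .univ) ((Lp.coeFn_compMeasurePreserving f
          (measurePreserving_snd_compProd h)).mono fun p hp _ => hp)
    _ = ∫ x in s, ∫ y, f y ∂(κ x) ∂π := by
        rw [Measure.setIntegral_compProd hs .univ hint.integrableOn]
        simp only [Measure.restrict_univ]

theorem transitionOp_comp (hκ : κ.Invariant π) (hη : η.Invariant π) :
    transitionOp 𝕜 (hκ.comp hη) = transitionOp 𝕜 hη ∘L transitionOp 𝕜 hκ := by
  ext1 f
  refine Lp.ext ?_
  have hκf : ∀ᵐ x ∂π, ∀ᵐ y ∂(η x), transitionOp 𝕜 hκ f y = ∫ z, f z ∂(κ y) :=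
    Measure.ae_ae_of_ae_compProd
      ((measurePreserving_snd_compProd hη).quasiMeasurePreserving.ae (transitionOp_ae_eq hκ f))
  have hint : ∀ᵐ x ∂π, Integrable f ((κ ∘ₖ η) x) :=
    (integrable_comp_snd_compProd (hκ.comp hη) f).ae_of_compProd
  filter_upwards [transitionOp_ae_eq (hκ.comp hη) f, transitionOp_ae_eq hη (transitionOp 𝕜 hκ f),
    hκf, hint] with x hcomp hηx hκx hx
  calc transitionOp 𝕜 (hκ.comp hη) f x = ∫ z, f z ∂((κ ∘ₖ η) x) := hcomp
    _ = ∫ y, ∫ z, f z ∂(κ y) ∂(η x) := Kernel.integral_comp hx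
    _ = ∫ y, transitionOp 𝕜 hκ f y ∂(η x) := (integral_congr_ae hκx).symm
    _ = transitionOp 𝕜 hη (transitionOp 𝕜 hκ f) x := hηx.symm

theorem transitionOp_pow (h : κ.Invariant π) (n : ℕ) :
    transitionOp 𝕜 (invariant_pow h n) = transitionOp 𝕜 h ^ n := by
  induction n with
  | zero =>
    ext1 f
    refine Lp.ext ((transitionOp_ae_eq (invariant_pow h 0) f).trans (.of_forall fun x => ?_))
    exact integral_dirac' _ x (Lp.stronglyMeasurable f)
  | succ n ih =>
    calc transitionOp 𝕜 (invariant_pow h (n + 1))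
        = transitionOp 𝕜 h ∘L transitionOp 𝕜 (invariant_pow h n) :=
          transitionOp_comp (invariant_pow h n) h
      _ = transitionOp 𝕜 h ^ (n + 1) := by rw [ih]; exact (pow_succ' _ n).symm

end TransitionOperator

section Autocovariance

variable {S : Type*} [MeasurableSpace S] {Q : Kernel S S} [IsMarkovKernel Q] {π : Measure S}
  [IsProbabilityMeasure π] {g : S → ℝ}

theorem autocov_eq_integral (hinv : Q.Invariant π) (hg : AEStronglyMeasurable g π) (k : ℤ) :
    autocov Q π g k = ∫ p, (g p.1 - π[g]) * (g p.2 - π[g]) ∂(π ⊗ₘ (Q ^ k.natAbs)) := by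
  have hfst := (measurePreserving_fst_compProd (π := π) (Q ^ k.natAbs)).hasLaw.integral_comp hg
  have hsnd :=
    (measurePreserving_snd_compProd (invariant_pow hinv k.natAbs)).hasLaw.integral_comp hg
  simp only [Function.comp_def] at hfst hsnd
  rw [autocov, covariance, hfst, hsnd]

-- The scalars are complex because the spectral calculus needs the C⋆-algebra of operators on a
-- complex Hilbert space.
theorem autocov_eq_re_inner (hinv : Q.Invariant π) (hg : AEStronglyMeasurable g π)
    {G : Lp ℂ 2 π} (hG : G =ᵐ[π] fun x => ((g x - π[g] : ℝ) : ℂ)) (k : ℤ) :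
    autocov Q π g k = (⟪G, (transitionOp ℂ hinv ^ k.natAbs) G⟫_ℂ).re := by
  have hfst := (measurePreserving_fst_compProd (π := π) (Q ^ k.natAbs)).quasiMeasurePreserving.ae hG
  have hsnd := (measurePreserving_snd_compProd
    (invariant_pow hinv k.natAbs)).quasiMeasurePreserving.ae hG
  have hinner : ⟪G, (transitionOp ℂ hinv ^ k.natAbs) G⟫_ℂ =
      ∫ p, (((g p.1 - π[g]) * (g p.2 - π[g]) : ℝ) : ℂ) ∂(π ⊗ₘ (Q ^ k.natAbs)) := by
    rw [← transitionOp_pow, inner_transitionOp_eq_integral]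
    refine integral_congr_ae ?_
    filter_upwards [hfst, hsnd] with p hp₁ hp₂
    rw [hp₁, hp₂, RCLike.inner_apply, Complex.conj_ofReal, Complex.ofReal_mul, mul_comm]
  rw [hinner, integral_complex_ofReal, Complex.ofReal_re, autocov_eq_integral hinv hg]

theorem autocov_mem_momentSpace (hrev : Q.IsReversible π) (hg : MemLp g 2 π) :
    autocov Q π g ∈ momentSpace (-1) 1 := by
  have hcentered : MemLp (fun x => ((g x - π[g] : ℝ) : ℂ)) 2 π :=
    (hg.sub (memLp_const π[g])).ofReal
  exact mem_momentSpace_of_isSelfAdjoint (isSelfAdjoint_transitionOp hrev)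
    (spectrum_subset_Icc_of_norm_le_one (norm_transitionOp_le hrev.invariant))
    (autocov_eq_re_inner hrev.invariant hg.1 hcentered.coeFn_toLp)

end Autocovariance

end MomentLS

theorem mainTheorem3_general {S Ω : Type*} [MeasurableSpace S] [MeasurableSpace Ω]
    (P : Measure Ω) (Q : Kernel S S) [IsMarkovKernel Q]
    (π : Measure S) [IsProbabilityMeasure π] (hrev : Q.IsReversible π)
    (g : S → ℝ) (hg : MemLp g 2 π) (r : ℕ → Ω → ℤ → ℝ)
    (hr : MomentLS.IsInitialEstimator P (MomentLS.autocov Q π g) r) :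
    (∃! F, MomentLS.IsRepresentingMeasure (MomentLS.autocov Q π g) F) ∧
    ∀ δ : ℝ, 0 < δ →
      (MomentLS.representingMeasure (MomentLS.autocov Q π g)).support
        ⊆ Set.Icc (-1 + δ) (1 - δ) →
      ∀ᵐ ω ∂P,
        (∀ M : ℕ, (∃! m, MomentLS.IsMomentLSE δ (r M ω) m) ∧
          ∃! μ, MomentLS.IsRepresentingMeasure (MomentLS.momentLSE δ (r M ω)) μ) ∧
        MomentLS.VaguelyTendsto
          (fun M => MomentLS.representingMeasure (MomentLS.momentLSE δ (r M ω)))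
          (MomentLS.representingMeasure (MomentLS.autocov Q π g)) := by
  have hγ := MomentLS.autocov_mem_momentSpace hrev hg
  refine ⟨MomentLS.existsUnique_isRepresentingMeasure hγ, fun δ hδ hsupp => ?_⟩
  have hγδ : MomentLS.autocov Q π g ∈ MomentLS.momentSpace (-1 + δ) (1 - δ) :=
    ⟨_, MomentLS.isRepresentingMeasure_representingMeasure hγ, hsupp⟩
  filter_upwards [ae_all_iff.2 hr.tendsto, ae_all_iff.2 hr.finite_support,
    ae_all_iff.2 hr.even, ae_all_iff.2 hr.peak] with ω htendsto hfinite heven hpeak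
  have hsum : ∀ M, Summable fun k => r M ω k ^ 2 := fun M =>
    (hfinite M).elim fun _ => MomentLS.summable_sq_of_even_of_eventually_zero (heven M)
  have hlse : ∀ M, MomentLS.IsMomentLSE δ (r M ω) (MomentLS.momentLSE δ (r M ω)) := fun M =>
    MomentLS.isMomentLSE_momentLSE δ (hsum M)
  have hlim : Tendsto (fun M => MomentLS.momentLSE δ (r M ω)) atTop
      (𝓝 (MomentLS.autocov Q π g)) :=
    MomentLS.tendsto_of_isMomentLSE hδ hlse hγδ htendsto hsum hpeak
  exact ⟨fun M => ⟨MomentLS.existsUnique_isMomentLSE δ (hsum M),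
      MomentLS.existsUnique_isRepresentingMeasure (hlse M).1.1⟩,
    MomentLS.vaguelyTendsto_representingMeasure (fun M => (hlse M).1.1) hγδ hlim⟩

theorem mainTheorem3 {S Ω : Type*}
    [MetricSpace S] [CompleteSpace S] [TopologicalSpace.SeparableSpace S]
    [MeasurableSpace S] [BorelSpace S]
    [MeasurableSpace Ω] (P : Measure Ω) [IsProbabilityMeasure P]
    (Q : Kernel S S) [IsMarkovKernel Q]
    (π : Measure S) [IsProbabilityMeasure π] (hrev : Q.IsReversible π)
    (ψ : Measure S) [IsProbabilityMeasure ψ] (hirr : MomentLS.IsPsiIrreducible Q ψ)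
    (hdrift : MomentLS.HasGeometricDrift Q)
    (haper : MomentLS.IsAperiodic Q ψ)
    (X : ℕ → Ω → S) (hX : MomentLS.IsMarkovChain Q P X)
    (g : S → ℝ) (hg : MemLp g 2 π)
    (r : (M : ℕ) → (Fin M → S) → ℤ → ℝ)
    (hr : MomentLS.IsInitialEstimator P (MomentLS.autocov Q π g)
      (fun M ω => r M (fun i => X i ω))) :
    (∃! F, MomentLS.IsRepresentingMeasure (MomentLS.autocov Q π g) F) ∧
    ∀ δ : ℝ, 0 < δ →
      (MomentLS.representingMeasure (MomentLS.autocov Q π g)).support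
        ⊆ Set.Icc (-1 + δ) (1 - δ) →
      ∀ᵐ ω ∂P,
        (∀ M : ℕ, (∃! m, MomentLS.IsMomentLSE δ (r M (fun i => X i ω)) m) ∧
          ∃! μ, MomentLS.IsRepresentingMeasure
            (MomentLS.momentLSE δ (r M (fun i => X i ω))) μ) ∧
        MomentLS.VaguelyTendsto
          (fun M => MomentLS.representingMeasure
            (MomentLS.momentLSE δ (r M (fun i => X i ω))))
          (MomentLS.representingMeasure (MomentLS.autocov Q π g)) :=
  mainTheorem3_general P Q π hrev g hg _ hr
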